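/- Let $N\ge3$ players, labelled $1,\dots,N$ modulo $N$, sit in a circle, each being a loser ($0$) or a winner ($1$), and let $x\in\Sigma:=\{0,1\}^N$ be the vector of statuses. For parameters $p=(p_0,p_1,p_2,p_3)\in[0,1]^4$, at each turn a uniformly chosen player $i$ tosses a coin with probability of heads $p_{m_i(x)}$, where $m_i(x)=2x_{i-1}+x_{i+1}$; with heads he wins one unit and his status becomes $1$, with tails he loses one unit and his status becomes $0$. Let $P_p$ be the resulting one-step transition matrix on $\Sigma$. Let $\{(X(n),I(n))\}_{n\ge0}$ be the Markov chain in $\Sigma\times\{1,\dots,N\}$ that records the statuses and the next player to play (uniformly chosen at each step), with arbitrary initial distribution, and let $S_n$ be the total profit of the $N$ players after $n$ turns. The mean profit per turn $\mu^N(p)$ is the real number, if there is one, such that $S_n/n\to\mu^N(p)$ almost surely for every initial distribution. Let $p_0=1$, $p_1=p_2\in(1/2,1)$, $p_3=0$. Put $\mu_B^N:=\mu^N(p_0,p_1,p_2,p_3)$ and $\mu_C^N:=\mu^N(p^C)$ with $p^C_m:=(1/2+p_m)/2$ for $m=0,1,2,3$ (at each turn a fair coin decides whether game $B$ or a fair coin-tossing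 game is played). Then, for every $N\ge 3$, $\mu_B^N$ and $\mu_C^N$ exist, and (a) $\mu_B^N=0$ if $N$ is even; (b) $\mu_B^N=(p_1+p_2-1)/N>0$ if $N$ is odd; (c) $P_{p^C}$ has a unique stationary distribution $\pi$ on $\Sigma$, and $\mu_C^N=\tfrac23(2p_1-1)\,\pi_{1,3}(0,1)>0$, where $\pi_{1,3}(0,1):=\pi\{x: x_1=0,\ x_3=1\}$. In particular, the Parrondo effect (that is, $\mu_B^N\le0$ and $\mu_C^N>0$) is present if and only if $N$ is even. -/

import Mathlib

open Filter Topology MeasureTheory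

namespace Parrondo

/-- Status (0 = loser, 1 = winner) of each of the `N` players on the circle; player `i`
(`1 ≤ i ≤ N`) is labelled by the residue of `i` modulo `N`. -/
abbrev State (N : ℕ) : Type := ZMod N → Fin 2

/-- State of the more informative chain: the statuses, and the next player to play. -/
abbrev StarState (N : ℕ) : Type := State N × ZMod N

/-- `m_i(x) = 2 x_{i-1} + x_{i+1}`. -/
def nbr {N : ℕ} (x : State N) (i : ZMod N) : Fin 4 :=
  ⟨2 * (x (i - 1)).val + (x (i + 1)).val, by omega⟩

/-- The state `x^i`, equal to `x` except at the `i`th component. -/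
def flip {N : ℕ} (x : State N) (i : ZMod N) : State N :=
  Function.update x i (1 - x i)

noncomputable section

/-- Probability that the status of player `i` changes when he plays in state `x`. -/
def changeProb {N : ℕ} (p : Fin 4 → ℝ) (x : State N) (i : ZMod N) : ℝ :=
  if x i = 0 then p (nbr x i) else 1 - p (nbr x i)

/-- Probability that the status of player `i` does not change when he plays in state `x`. -/
def stayProb {N : ℕ} (p : Fin 4 → ℝ) (x : State N) (i : ZMod N) : ℝ :=
  if x i = 0 then 1 - p (nbr x i) else p (nbr x i)

/-- One-step transition matrix on `{0,1}^N`. -/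
def P (N : ℕ) [NeZero N] (p : Fin 4 → ℝ) : Matrix (State N) (State N) ℝ := fun x y =>
  (N : ℝ)⁻¹ * ∑ i : ZMod N,
    ((if y = flip x i then changeProb p x i else 0) + (if y = x then stayProb p x i else 0))

/-- One-step transition matrix on `{0,1}^N × {1,…,N}`. -/
def PStar (N : ℕ) [NeZero N] (p : Fin 4 → ℝ) : Matrix (StarState N) (StarState N) ℝ :=
  fun z w =>
    (N : ℝ)⁻¹ *
      ((if w.1 = flip z.1 z.2 then changeProb p z.1 z.2 else 0) +
        (if w.1 = z.1 then stayProb p z.1 z.2 else 0))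

/-- `π` is a stationary distribution of the transition matrix `Q`. -/
structure IsStationary {S : Type*} [Fintype S] (Q : Matrix S S ℝ) (π : S → ℝ) : Prop where
  nonneg : ∀ x, 0 ≤ π x
  sum_eq_one : ∑ x, π x = 1
  stationary : Matrix.vecMul π Q = π

/-- The two-dimensional marginal `π_{1,3}(u,v)` of a distribution `π` on `{0,1}^N`. -/
def marginal13 {N : ℕ} [NeZero N] (π : State N → ℝ) (u v : Fin 2) : ℝ :=
  ∑ x : State N, if x 1 = u ∧ x 3 = v then π x else 0

/-- `Z` is a time-homogeneous Markov chain with transition matrix `Q`, with an arbitrary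
initial distribution, on the probability space `(Ω, ℙ)`. -/
structure IsMarkovChain {S Ω : Type*} [MeasurableSpace Ω] (ℙ : Measure Ω)
    (Q : Matrix S S ℝ) (Z : ℕ → Ω → S) : Prop where
  measurableSet_fiber : ∀ n s, MeasurableSet {ω | Z n ω = s}
  law : ∀ (n : ℕ) (z : ℕ → S),
    ℙ.real {ω | ∀ k ≤ n, Z k ω = z k} =
      ℙ.real {ω | Z 0 ω = z 0} * ∏ k ∈ Finset.range n, Q (z k) (z (k + 1))

/-- Profit of a turn that leads from `z = (x, i)` to `w = (y, j)`: player `i` has played, and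
he has won one unit if he is a winner now and lost one unit if he is a loser now. -/
def payoff {N : ℕ} (z w : StarState N) : ℝ := if w.1 z.2 = 1 then 1 else -1

/-- Total profit of the `N` players after `n` turns. -/
def totalProfit {N : ℕ} {Ω : Type*} (Z : ℕ → Ω → StarState N) (n : ℕ) (ω : Ω) : ℝ :=
  ∑ k ∈ Finset.range n, payoff (Z k ω) (Z (k + 1) ω)

/-- `μ` is the mean profit per turn to the ensemble of `N` players of the game with probability
parameters `p`: for every initial distribution, the profit per turn up to time `n` converges
to `μ` almost surely. -/
def IsMeanProfit (N : ℕ) [NeZero N] (p : Fin 4 → ℝ) (μ : ℝ) : Prop :=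
  ∀ (Ω : Type) [MeasurableSpace Ω] (ℙ : Measure Ω) [IsProbabilityMeasure ℙ]
    (Z : ℕ → Ω → StarState N), IsMarkovChain ℙ (PStar N p) Z →
      ∀ᵐ ω ∂ℙ, Tendsto (fun n : ℕ => totalProfit Z n ω / n) atTop (𝓝 μ)

/-- Parameters of game `C = (A + B) / 2`, where `B` has parameters `p` and `A` is fair. -/
def gameC (p : Fin 4 → ℝ) : Fin 4 → ℝ := fun m => (1 / 2 + p m) / 2

/-- The Parrondo effect: game `B` is losing or fair, and game `C` is winning. -/
def ParrondoEffect (N : ℕ) [NeZero N] (p : Fin 4 → ℝ) : Prop :=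
  ∃ μB μC : ℝ, IsMeanProfit N p μB ∧ IsMeanProfit N (gameC p) μC ∧ μB ≤ 0 ∧ 0 < μC

end

end Parrondo

/-!
The number `s` of winners drifts by `N⁻¹ (∑ᵢ p(mᵢ) - s)` per turn and the mean profit is
`N⁻¹ ∑ᵢ (2 p(mᵢ) - 1)`. For `p = (1, p₁, p₂, 0)` the sum `∑ᵢ p(mᵢ)` is `N - s + (p₁ + p₂ - 1) a`,
where `a` counts the players with a loser on their left and a winner on their right, so the mean
profit is a multiple of the drift of `s` plus a multiple of `a`, both in game `B` and in game `C`.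
The drift averages out, so the mean profit per turn exists and is a multiple of the average of `a`
as soon as `a` has the same average under all stationary distributions: by the Fredholm
alternative `a` minus its average is then `f - P f` for some `f`, and the strong law for bounded
martingale differences applies.

Game `B`: call `i` a defect if players `i` and `i + 1` have the same status. A turn never creates
defects; it moves a defect to a neighbouring site or annihilates two adjacent ones, and any two
defects can be brought together. So recurrent states have at most one defect, and `a` equals the
number of defects there; since that number is congruent to `N` modulo 2, `a` is 0 for even `N`
and 1 for odd `N`.

Game `C`: all parameters lie in `(0, 1)`, so the chain is irreducible and its stationary
distribution `π` is unique, hence invariant under rotations. The average of `a` is therefore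
`N π₁₃(0, 1)`.
-/

namespace Parrondo

section StrongLaw

lemma tendsto_average_of_tendsto_average_sq {a : ℕ → ℝ} {C : ℝ} (ha : ∀ n, |a n| ≤ C)
    (h : Tendsto (fun n : ℕ => (∑ k ∈ Finset.range (n ^ 2), a k) / (n ^ 2 : ℕ)) atTop (𝓝 0)) :
    Tendsto (fun n : ℕ => (∑ k ∈ Finset.range n, a k) / n) atTop (𝓝 0) := by
  -- Adding `C` to every term makes the partial sums monotone.
  set b : ℕ → ℝ := fun n => ∑ k ∈ Finset.range n, a k + C * n
  have b_mono : Monotone b := monotone_nat_of_le_succ fun n => by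
    simp only [b, Finset.sum_range_succ, Nat.cast_succ]
    linarith [(abs_le.1 (ha n)).1]
  have b_div : ∀ᶠ n : ℕ in atTop, (∑ k ∈ Finset.range n, a k) / n + C = b n / n := by
    filter_upwards [eventually_ne_atTop 0] with n hn
    simp only [b]
    field_simp
  have sq_tendsto : Tendsto (fun n : ℕ => n ^ 2) atTop atTop := tendsto_pow_atTop two_ne_zero
  have b_sq : Tendsto (fun n : ℕ => b (n ^ 2) / (n ^ 2 : ℕ)) atTop (𝓝 C) := by
    rw [← zero_add C]
    exact (h.add_const C).congr' (sq_tendsto.eventually b_div)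
  have succ_sq_le : ∀ c : ℝ, 1 < c →
      ∀ᶠ n : ℕ in atTop, (((n + 1) ^ 2 : ℕ) : ℝ) ≤ c * (n ^ 2 : ℕ) := fun c hc => by
    have : Tendsto (fun n : ℕ => (1 + 1 / (n : ℝ)) ^ 2) atTop (𝓝 ((1 + 0) ^ 2)) :=
      (tendsto_const_nhds.add tendsto_one_div_atTop_nhds_zero_nat).pow 2
    filter_upwards [this.eventually_lt_const (by simpa using hc), eventually_ne_atTop 0]
      with n hn hn0
    push_cast
    calc ((n : ℝ) + 1) ^ 2 = (1 + 1 / (n : ℝ)) ^ 2 * (n : ℝ) ^ 2 := by field_simp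
      _ ≤ c * (n : ℝ) ^ 2 := by gcongr
  have b_lim := tendsto_div_of_monotone_of_exists_subseq_tendsto_div b C b_mono
    fun c hc => ⟨fun n => n ^ 2, succ_sq_le c hc, sq_tendsto, b_sq⟩
  simpa only [add_sub_cancel_right, sub_self] using
    (b_lim.congr' (b_div.mono fun n hn => hn.symm)).sub_const C

variable {Ω : Type*} [MeasurableSpace Ω] {ℙ : Measure Ω}

lemma ae_tendsto_zero_of_summable_integral {Y : ℕ → Ω → ℝ} (hY : ∀ n, Integrable (Y n) ℙ)
    (nonneg : ∀ n ω, 0 ≤ Y n ω) (hsum : Summable fun n => ∫ ω, Y n ω ∂ℙ) :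
    ∀ᵐ ω ∂ℙ, Tendsto (fun n => Y n ω) atTop (𝓝 0) := by
  have norm_eq : ∀ n, eLpNorm (Y n) 1 ℙ = ENNReal.ofReal (∫ ω, Y n ω ∂ℙ) := fun n => by
    rw [eLpNorm_one_eq_lintegral_enorm, ofReal_integral_eq_lintegral_ofReal (hY n)
      (ae_of_all _ (nonneg n))]
    exact lintegral_congr fun ω => Real.enorm_of_nonneg (nonneg n ω)
  have hfin : ∑' n, eLpNorm (Y n) 1 ℙ ≠ ⊤ := by
    simpa only [norm_eq] using hsum.tsum_ofReal_ne_top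
  filter_upwards [summable_norm_of_tsum_eLpNorm_ne_top le_rfl
    (fun n => (hY n).aestronglyMeasurable) hfin] with ω hω
  exact tendsto_zero_iff_norm_tendsto_zero.2 hω.tendsto_atTop_zero

variable [IsProbabilityMeasure ℙ] {ξ : ℕ → Ω → ℝ} {C : ℝ}

lemma integral_sq_sum_le_of_orthogonal (hξ : ∀ n, Measurable (ξ n)) (hC : ∀ n ω, |ξ n ω| ≤ C)
    (orth : ∀ i j, i < j → ∫ ω, ξ i ω * ξ j ω ∂ℙ = 0) (n : ℕ) :
    ∫ ω, (∑ k ∈ Finset.range n, ξ k ω) ^ 2 ∂ℙ ≤ n * C ^ 2 := by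
  have memLp : ∀ k, MemLp (ξ k) 2 ℙ := fun k =>
    .of_bound (hξ k).aestronglyMeasurable C (ae_of_all _ (hC k))
  have int_mul : ∀ i j, Integrable (fun ω => ξ i ω * ξ j ω) ℙ := fun i j =>
    (memLp i).integrable_mul (memLp j)
  have diagonal : ∀ i, ∫ ω, ξ i ω * ξ i ω ∂ℙ ≤ C ^ 2 := fun i => by
    have := integral_mono (int_mul i i) (integrable_const (C ^ 2)) fun ω => by
      simpa only [← sq] using sq_le_sq' (abs_le.1 (hC i ω)).1 (abs_le.1 (hC i ω)).2
    simpa using this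
  have off_diagonal : ∀ i j, i ≠ j → ∫ ω, ξ i ω * ξ j ω ∂ℙ = 0 := fun i j hij => by
    rcases hij.lt_or_gt with h | h
    · exact orth i j h
    · simpa only [mul_comm] using orth j i h
  calc ∫ ω, (∑ k ∈ Finset.range n, ξ k ω) ^ 2 ∂ℙ
      = ∑ i ∈ Finset.range n, ∑ j ∈ Finset.range n, ∫ ω, ξ i ω * ξ j ω ∂ℙ := by
        simp_rw [sq, Finset.sum_mul_sum]
        rw [integral_finsetSum _ fun i _ => integrable_finsetSum _ fun j _ => int_mul i j]
        exact Finset.sum_congr rfl fun i _ => integral_finsetSum _ fun j _ => int_mul i j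
    _ = ∑ i ∈ Finset.range n, ∫ ω, ξ i ω * ξ i ω ∂ℙ :=
        Finset.sum_congr rfl fun i hi =>
          Finset.sum_eq_single_of_mem i hi fun j _ hj => off_diagonal i j hj.symm
    _ ≤ ∑ _i ∈ Finset.range n, C ^ 2 := Finset.sum_le_sum fun i _ => diagonal i
    _ = n * C ^ 2 := by rw [Finset.sum_const, Finset.card_range, nsmul_eq_mul]

theorem ae_tendsto_average_of_orthogonal (hξ : ∀ n, Measurable (ξ n)) (hC : ∀ n ω, |ξ n ω| ≤ C)
    (orth : ∀ i j, i < j → ∫ ω, ξ i ω * ξ j ω ∂ℙ = 0) :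
    ∀ᵐ ω ∂ℙ, Tendsto (fun n : ℕ => (∑ k ∈ Finset.range n, ξ k ω) / n) atTop (𝓝 0) := by
  let Y : ℕ → Ω → ℝ := fun n ω => ((∑ k ∈ Finset.range (n ^ 2), ξ k ω) / (n ^ 2 : ℕ)) ^ 2
  have Y_integrable : ∀ n, Integrable (Y n) ℙ := fun n => by
    have sum_memLp : MemLp (fun ω => ∑ k ∈ Finset.range (n ^ 2), ξ k ω) 2 ℙ :=
      memLp_finsetSum _ fun k _ =>
        .of_bound (hξ k).aestronglyMeasurable C (ae_of_all _ (hC k))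
    simpa only [Y, div_pow] using sum_memLp.integrable_sq.div_const _
  have integral_Y_le : ∀ n, ∫ ω, Y n ω ∂ℙ ≤ 1 / (n : ℝ) ^ 2 * C ^ 2 := fun n => by
    rcases eq_or_ne n 0 with rfl | hn
    · simp [Y]
    simp only [Y, div_pow]
    rw [integral_div, div_le_iff₀ (by positivity)]
    refine (integral_sq_sum_le_of_orthogonal hξ hC orth (n ^ 2)).trans_eq ?_
    push_cast
    field_simp
  have summable_Y : Summable fun n => ∫ ω, Y n ω ∂ℙ :=
    .of_nonneg_of_le (fun n => integral_nonneg fun ω => sq_nonneg _) integral_Y_le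
      ((Real.summable_one_div_nat_pow.2 one_lt_two).mul_right _)
  filter_upwards [ae_tendsto_zero_of_summable_integral Y_integrable (fun n ω => sq_nonneg _)
    summable_Y] with ω hω
  refine tendsto_average_of_tendsto_average_sq (fun n => hC n ω) ?_
  rw [tendsto_zero_iff_abs_tendsto_zero]
  simpa only [Y, Real.sqrt_zero, Real.sqrt_sq_eq_abs, Function.comp_def] using hω.sqrt

end StrongLaw

section MarkovChain

variable {S Ω : Type*} [MeasurableSpace Ω] {ℙ : Measure Ω} {Q : Matrix S S ℝ} {Z : ℕ → Ω → S}

lemma IsMarkovChain.real_path_eq (h : IsMarkovChain ℙ Q Z) {n : ℕ} (z : Fin (n + 1) → S) :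
    ℙ.real {ω | (fun k : Fin (n + 1) => Z k ω) = z} =
      ℙ.real {ω | Z 0 ω = z 0} * ∏ k : Fin n, Q (z k.castSucc) (z k.succ) := by
  have cast_eq : ∀ k (hk : k < n + 1), Fin.ofNat (n + 1) k = ⟨k, hk⟩ := fun k hk =>
    Fin.ext (Nat.mod_eq_of_lt hk)
  have path_iff : ∀ ω, (fun k : Fin (n + 1) => Z k ω) = z ↔
      ∀ k ≤ n, Z k ω = z (Fin.ofNat (n + 1) k) := fun ω => by
    simp only [funext_iff, Fin.forall_iff, ← Nat.lt_succ_iff]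
    exact forall₂_congr fun k hk => by rw [cast_eq k hk]
  simp only [path_iff, h.law n fun k => z (Fin.ofNat (n + 1) k), Finset.prod_range]
  congr 1
  refine Finset.prod_congr rfl fun k _ => ?_
  rw [cast_eq k (k.2.trans n.lt_succ_self), cast_eq (k + 1) (Nat.succ_lt_succ k.2)]
  rfl

lemma IsMarkovChain.real_path_eq_snoc (h : IsMarkovChain ℙ Q Z) {n : ℕ} (z : Fin (n + 1) → S)
    (w : S) :
    ℙ.real {ω | (fun k : Fin (n + 2) => Z k ω) = (Fin.snoc z w : Fin (n + 2) → S)} =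
      ℙ.real {ω | (fun k : Fin (n + 1) => Z k ω) = z} * Q (z (Fin.last n)) w := by
  have snoc_zero : (Fin.snoc z w : Fin (n + 2) → S) 0 = z 0 :=
    Fin.snoc_castSucc (α := fun _ => S) w z 0
  rw [h.real_path_eq, h.real_path_eq, Fin.prod_univ_castSucc, snoc_zero, mul_assoc]
  simp only [Fin.snoc_castSucc, Fin.succ_castSucc, Fin.succ_last, Fin.snoc_last]

variable [Fintype S]

lemma integral_comp_eq_sum {T : Type*} [Fintype T] [MeasurableSpace T]
    [DiscreteMeasurableSpace T] [IsFiniteMeasure ℙ] {X : Ω → T} (hX : Measurable X) (g : T → ℝ) :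
    ∫ ω, g (X ω) ∂ℙ = ∑ t, ℙ.real {ω | X ω = t} * g t := by
  rw [← integral_map hX.aemeasurable .of_discrete, integral_fintype .of_finite]
  refine Finset.sum_congr rfl fun t _ => ?_
  rw [map_measureReal_apply hX (measurableSet_singleton t), smul_eq_mul]
  rfl

lemma IsMarkovChain.integral_mul_eq_zero [MeasurableSpace S] [DiscreteMeasurableSpace S]
    [IsFiniteMeasure ℙ] (h : IsMarkovChain ℙ Q Z) (hZ : ∀ n, Measurable (Z n)) {φ : S → S → ℝ}
    (hφ : ∀ s, ∑ w, Q s w * φ s w = 0) {n : ℕ} (G : (Fin (n + 1) → S) → ℝ) :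
    ∫ ω, G (fun k => Z k ω) * φ (Z n ω) (Z (n + 1) ω) ∂ℙ = 0 := by
  have path_measurable : Measurable fun ω (k : Fin (n + 2)) => Z k ω :=
    measurable_pi_iff.2 fun k => hZ k
  calc ∫ ω, G (fun k => Z k ω) * φ (Z n ω) (Z (n + 1) ω) ∂ℙ
      = ∑ z : Fin (n + 2) → S, ℙ.real {ω | (fun k : Fin (n + 2) => Z k ω) = z} *
          (G (Fin.init z) * φ (z (Fin.last n).castSucc) (z (Fin.last (n + 1)))) :=
        integral_comp_eq_sum path_measurable fun z =>
          G (Fin.init z) * φ (z (Fin.last n).castSucc) (z (Fin.last (n + 1)))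
    _ = ∑ z : Fin (n + 1) → S, ∑ w,
          ℙ.real {ω | (fun k : Fin (n + 2) => Z k ω) = (Fin.snoc z w : Fin (n + 2) → S)} *
            (G z * φ (z (Fin.last n)) w) := by
        rw [← (Fin.snocEquiv fun _ : Fin (n + 2) => S).sum_comp, Fintype.sum_prod_type,
          Finset.sum_comm]
        simp only [Fin.snocEquiv, Equiv.coe_fn_mk, Fin.init_snoc, Fin.snoc_castSucc, Fin.snoc_last]
    _ = ∑ z : Fin (n + 1) → S, ℙ.real {ω | (fun k : Fin (n + 1) => Z k ω) = z} * G z *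
          ∑ w, Q (z (Fin.last n)) w * φ (z (Fin.last n)) w := by
        simp only [h.real_path_eq_snoc, Finset.mul_sum]
        exact Finset.sum_congr rfl fun z _ => Finset.sum_congr rfl fun w _ => by ring
    _ = 0 := by simp only [hφ, mul_zero, Finset.sum_const_zero]

lemma IsMarkovChain.ae_tendsto_average_of_centered [IsProbabilityMeasure ℙ]
    (h : IsMarkovChain ℙ Q Z) {φ : S → S → ℝ} (hφ : ∀ s, ∑ w, Q s w * φ s w = 0) :
    ∀ᵐ ω ∂ℙ, Tendsto (fun n : ℕ => (∑ k ∈ Finset.range n, φ (Z k ω) (Z (k + 1) ω)) / n)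
      atTop (𝓝 0) := by
  let _ : MeasurableSpace S := ⊤
  have hZ : ∀ n, Measurable (Z n) := fun n => measurable_to_countable' (h.measurableSet_fiber n)
  obtain ⟨C, hC⟩ := (Set.finite_range fun t : S × S => |φ t.1 t.2|).bddAbove
  refine ae_tendsto_average_of_orthogonal (fun n => ?_)
    (fun n ω => hC ⟨(Z n ω, Z (n + 1) ω), rfl⟩) fun i j hij => ?_
  · exact (Measurable.of_discrete (f := fun t : S × S => φ t.1 t.2)).comp
      ((hZ n).prodMk (hZ (n + 1)))
  · exact h.integral_mul_eq_zero hZ hφ (n := j)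
      fun z => φ (z ⟨i, by lia⟩) (z ⟨i + 1, by lia⟩)

/-- The Poisson equation `f - Q f = g - c` of a transition matrix `Q` is solvable. The constant
`c` is then the long-run average of the observable `g` along the chain, whatever the initial
distribution. -/
def HasPoissonMean (Q : Matrix S S ℝ) (g : S → ℝ) (c : ℝ) : Prop :=
  ∃ f : S → ℝ, ∀ s, f s - (Q.mulVec f) s = g s - c

lemma HasPoissonMean.add {g g' : S → ℝ} {c c' : ℝ} (h : HasPoissonMean Q g c)
    (h' : HasPoissonMean Q g' c') : HasPoissonMean Q (fun s => g s + g' s) (c + c') := by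
  obtain ⟨⟨f, hf⟩, f', hf'⟩ := And.intro h h'
  refine ⟨f + f', fun s => ?_⟩
  rw [Matrix.mulVec_add, Pi.add_apply, Pi.add_apply]
  linarith [hf s, hf' s]

lemma HasPoissonMean.const_mul {g : S → ℝ} {c : ℝ} (h : HasPoissonMean Q g c) (a : ℝ) :
    HasPoissonMean Q (fun s => a * g s) (a * c) := by
  obtain ⟨f, hf⟩ := h
  refine ⟨a • f, fun s => ?_⟩
  rw [Matrix.mulVec_smul, Pi.smul_apply, Pi.smul_apply, smul_eq_mul, smul_eq_mul, ← mul_sub,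
    hf s, mul_sub]

lemma hasPoissonMean_drift (Q : Matrix S S ℝ) (f : S → ℝ) :
    HasPoissonMean Q (fun s => (Q.mulVec f) s - f s) 0 :=
  ⟨-f, fun s => by rw [Matrix.mulVec_neg, Pi.neg_apply, Pi.neg_apply]; ring⟩

theorem IsMarkovChain.ae_tendsto_average [IsProbabilityMeasure ℙ] (h : IsMarkovChain ℙ Q Z)
    (hQ : Q.mulVec 1 = 1) {r : S → S → ℝ} {c : ℝ}
    (hr : HasPoissonMean Q (fun s => ∑ w, Q s w * r s w) c) :
    ∀ᵐ ω ∂ℙ, Tendsto (fun n : ℕ => (∑ k ∈ Finset.range n, r (Z k ω) (Z (k + 1) ω)) / n)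
      atTop (𝓝 c) := by
  obtain ⟨f, hf⟩ := hr
  have row_sum : ∀ s, ∑ w, Q s w = 1 := fun s => by
    simpa only [Matrix.mulVec, dotProduct_one, Pi.one_apply] using congrFun hQ s
  let φ : S → S → ℝ := fun s w => r s w - c + (f w - f s)
  have centered : ∀ s, ∑ w, Q s w * φ s w = 0 := fun s => by
    have hfs := hf s
    simp only [Matrix.mulVec, dotProduct] at hfs
    simp only [φ, mul_add, mul_sub, Finset.sum_add_distrib, Finset.sum_sub_distrib,
      ← Finset.sum_mul, row_sum]
    linarith
  obtain ⟨C, hC⟩ := (Set.finite_range fun s => |f s|).bddAbove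
  filter_upwards [h.ae_tendsto_average_of_centered centered] with ω hω
  have boundary : Tendsto (fun n : ℕ => (f (Z n ω) - f (Z 0 ω)) / n) atTop (𝓝 0) := by
    have bound : ∀ n, |f (Z n ω) - f (Z 0 ω)| ≤ C + C := fun n =>
      (abs_sub _ _).trans (add_le_add (hC ⟨_, rfl⟩) (hC ⟨_, rfl⟩))
    exact tendsto_bdd_div_atTop_nhds_zero (.of_forall fun n => (abs_le.1 (bound n)).1)
      (.of_forall fun n => (abs_le.1 (bound n)).2) tendsto_natCast_atTop_atTop
  have lim := (hω.sub boundary).add_const c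
  rw [sub_zero, zero_add] at lim
  refine lim.congr' ?_
  filter_upwards [eventually_ne_atTop 0] with n hn
  simp only [φ, Finset.sum_add_distrib, Finset.sum_sub_distrib,
    Finset.sum_range_sub fun k => f (Z k ω), Finset.sum_const, Finset.card_range, nsmul_eq_mul]
  field_simp
  ring

end MarkovChain

section StationaryDistribution

open Matrix

/-- State `y` can be reached from state `x` in finitely many steps, possibly none, of positive
`Q`-probability. -/
def Reaches {S : Type*} (Q : Matrix S S ℝ) : S → S → Prop :=
  Relation.ReflTransGen fun x y => 0 < Q x y

variable {S : Type*} [Fintype S] {Q : Matrix S S ℝ} {π π' g : S → ℝ} {c : ℝ}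

lemma IsStationary.submatrix {T : Type*} [Fintype T] (hπ : IsStationary Q π) (e : T ≃ S) :
    IsStationary (Q.submatrix e e) (π ∘ e) where
  nonneg t := hπ.nonneg (e t)
  sum_eq_one := (e.sum_comp π).trans hπ.sum_eq_one
  stationary := by
    rw [submatrix_vecMul_equiv, Function.comp_assoc, e.self_comp_symm, Function.comp_id,
      hπ.stationary]

lemma IsStationary.dotProduct_mulVec (hπ : IsStationary Q π) (f : S → ℝ) :
    π ⬝ᵥ Q *ᵥ f = π ⬝ᵥ f := by
  rw [Matrix.dotProduct_mulVec, hπ.stationary]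

lemma IsStationary.exists_pos (hπ : IsStationary Q π) : ∃ x, 0 < π x := by
  by_contra! h
  exact one_ne_zero (hπ.sum_eq_one.symm.trans
    (Finset.sum_eq_zero fun x _ => (h x).antisymm (hπ.nonneg x)))

lemma isStationary_of_vecMul_eq {u : S → ℝ} (hu : u ᵥ* Q = u) (nonneg : ∀ x, 0 ≤ u x)
    (hu0 : u ≠ 0) : IsStationary Q ((∑ x, u x)⁻¹ • u) where
  nonneg x := mul_nonneg (inv_nonneg.2 (Finset.sum_nonneg fun y _ => nonneg y)) (nonneg x)
  sum_eq_one := by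
    have sum_ne_zero : ∑ x, u x ≠ 0 := fun h => hu0 <| funext fun x =>
      (Finset.sum_eq_zero_iff_of_nonneg fun y _ => nonneg y).1 h x (Finset.mem_univ x)
    simp only [Pi.smul_apply, smul_eq_mul, ← Finset.mul_sum]
    exact inv_mul_cancel₀ sum_ne_zero
  stationary := by rw [smul_vecMul, hu]

lemma dotProduct_eq_zero_of_vecMul_eq {u : S → ℝ} (hu : u ᵥ* Q = u) (nonneg : ∀ x, 0 ≤ u x)
    (hg : ∀ π, IsStationary Q π → π ⬝ᵥ g = 0) : u ⬝ᵥ g = 0 := by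
  rcases eq_or_ne u 0 with rfl | hu0
  · exact zero_dotProduct g
  · have hstat := isStationary_of_vecMul_eq hu nonneg hu0
    have sum_inv_ne_zero : (∑ x, u x)⁻¹ ≠ 0 := fun h => by
      simpa [h] using hstat.sum_eq_one
    simpa [smul_dotProduct, sum_inv_ne_zero] using hg _ hstat

variable [DecidableEq S]

lemma abs_vecMul_eq_self (hQ : Q ∈ rowStochastic ℝ S) {v : S → ℝ} (hv : v ᵥ* Q = v) :
    |v| ᵥ* Q = |v| := by
  have le : ∀ y ∈ Finset.univ, |v| y ≤ (|v| ᵥ* Q) y := fun y _ =>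
    calc |v y| = |∑ x, v x * Q x y| := congrArg abs (congrFun hv y).symm
      _ ≤ ∑ x, |v x * Q x y| := Finset.abs_sum_le_sum_abs _ _
      _ = ∑ x, |v x| * Q x y := by
        simp only [abs_mul, abs_of_nonneg (nonneg_of_mem_rowStochastic hQ)]
  have sum_eq : ∑ y, |v| y = ∑ y, (|v| ᵥ* Q) y := by
    rw [← dotProduct_one, ← dotProduct_one, ← Matrix.dotProduct_mulVec,
      one_vecMul_of_mem_rowStochastic hQ]
  exact funext fun y => ((Finset.sum_eq_sum_iff_of_le le).1 sum_eq y (Finset.mem_univ y)).symm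

lemma exists_isStationary [Nonempty S] (hQ : Q ∈ rowStochastic ℝ S) : ∃ π, IsStationary Q π := by
  have singular : (Q - 1).det = 0 := exists_mulVec_eq_zero_iff.1
    ⟨1, one_ne_zero, by rw [sub_mulVec, one_vecMul_of_mem_rowStochastic hQ, one_mulVec, sub_self]⟩
  obtain ⟨v, hv0, hv⟩ := exists_vecMul_eq_zero_iff.2 singular
  rw [vecMul_sub, vecMul_one, sub_eq_zero] at hv
  exact ⟨_, isStationary_of_vecMul_eq (abs_vecMul_eq_self hQ hv) (fun x => abs_nonneg (v x))
    fun h => hv0 (funext fun x => abs_eq_zero.1 (congrFun h x))⟩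

/-- The Fredholm alternative: a functional that vanishes on the range of `1 - Q` is an invariant
vector `v`, and `v = (|v| + v) - |v|` is a difference of nonnegative invariant vectors. -/
theorem hasPoissonMean_of_forall_isStationary (hQ : Q ∈ rowStochastic ℝ S)
    (hg : ∀ π, IsStationary Q π → π ⬝ᵥ g = c) : HasPoissonMean Q g c := by
  let u : S → ℝ := g - c • 1
  have u_mean : ∀ π, IsStationary Q π → π ⬝ᵥ u = 0 := fun π hπ => by
    rw [dotProduct_sub, dotProduct_smul, dotProduct_one, hπ.sum_eq_one, hg π hπ, smul_eq_mul,
      mul_one, sub_self]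
  suffices hu : u ∈ (1 - Q).mulVecLin.range by
    obtain ⟨f, hf⟩ := hu
    refine ⟨f, fun s => ?_⟩
    simpa [sub_mulVec, u] using congrFun hf s
  by_contra hu
  obtain ⟨φ, hφu, hφ⟩ := Submodule.exists_le_ker_of_notMem hu
  obtain ⟨v, rfl⟩ := (dotProductEquiv ℝ S).surjective φ
  have hv : v ᵥ* Q = v := by
    have vanish : v ᵥ* (1 - Q) = 0 := dotProduct_eq_zero_iff.1 fun f => by
      rw [← Matrix.dotProduct_mulVec]
      exact hφ ⟨f, rfl⟩
    rw [vecMul_sub, vecMul_one, sub_eq_zero] at vanish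
    exact vanish.symm
  have habs := abs_vecMul_eq_self hQ hv
  have abs_mean : |v| ⬝ᵥ u = 0 :=
    dotProduct_eq_zero_of_vecMul_eq habs (fun x => abs_nonneg (v x)) u_mean
  have abs_add_mean : (|v| + v) ⬝ᵥ u = 0 :=
    dotProduct_eq_zero_of_vecMul_eq (by rw [add_vecMul, habs, hv])
      (fun x => neg_le_iff_add_nonneg.1 (neg_le_abs (v x))) u_mean
  rw [add_dotProduct, abs_mean, zero_add] at abs_add_mean
  exact hφu abs_add_mean

lemma IsStationary.pos_of_reaches (hQ : Q ∈ rowStochastic ℝ S) (hπ : IsStationary Q π) {x y : S}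
    (hx : 0 < π x) (hxy : Reaches Q x y) : 0 < π y := by
  induction hxy with
  | refl => exact hx
  | @tail a b _ hab ha =>
    calc 0 < π a * Q a b := mul_pos ha hab
      _ ≤ ∑ z, π z * Q z b := Finset.single_le_sum (f := fun z => π z * Q z b)
        (fun z _ => mul_nonneg (hπ.nonneg z) (nonneg_of_mem_rowStochastic hQ))
        (Finset.mem_univ a)
      _ = π b := congrFun hπ.stationary b

lemma IsStationary.pos (hQ : Q ∈ rowStochastic ℝ S) (irreducible : ∀ x y, Reaches Q x y)
    (hπ : IsStationary Q π) (x : S) : 0 < π x :=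
  hπ.exists_pos.elim fun y hy => hπ.pos_of_reaches hQ hy (irreducible y x)

lemma IsStationary.le (hQ : Q ∈ rowStochastic ℝ S) (irreducible : ∀ x y, Reaches Q x y)
    (hπ : IsStationary Q π) (hπ' : IsStationary Q π') (x : S) : π x ≤ π' x := by
  set v := π - π' with v_def
  have hv : v ᵥ* Q = v := by rw [sub_vecMul, hπ.stationary, hπ'.stationary]
  have v_sum : ∑ y, v y = 0 := by
    simp only [v_def, Pi.sub_apply, Finset.sum_sub_distrib, hπ.sum_eq_one, hπ'.sum_eq_one, sub_self]
  have nonneg : ∀ y, 0 ≤ |v y| + v y := fun y => neg_le_iff_add_nonneg.1 (neg_le_abs (v y))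
  by_contra! hx
  have vx_pos : 0 < v x := sub_pos.2 hx
  -- The invariant vector `|v| + v` is positive at `x`, hence everywhere, and so is `v`.
  have hstat := isStationary_of_vecMul_eq (u := |v| + v)
    (by rw [add_vecMul, abs_vecMul_eq_self hQ hv, hv]) nonneg
    fun h => (add_pos_of_nonneg_of_pos (abs_nonneg (v x)) vx_pos).ne' (congrFun h x)
  have v_pos : ∀ y, 0 < v y := fun y => by
    by_contra! hy
    have := hstat.pos hQ irreducible y
    simp [abs_of_nonpos hy] at this
  exact (Finset.sum_pos (fun y _ => v_pos y) ⟨x, Finset.mem_univ x⟩).ne' v_sum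

theorem IsStationary.eq (hQ : Q ∈ rowStochastic ℝ S) (irreducible : ∀ x y, Reaches Q x y)
    (hπ : IsStationary Q π) (hπ' : IsStationary Q π') : π = π' :=
  le_antisymm (hπ.le hQ irreducible hπ') (hπ'.le hQ irreducible hπ)

lemma IsStationary.eq_of_reaches_of_antitone (hQ : Q ∈ rowStochastic ℝ S)
    (hπ : IsStationary Q π) {D : S → ℝ} (hD : ∀ x y, 0 < Q x y → D y ≤ D x) {x y : S}
    (hx : 0 < π x) (hxy : Reaches Q x y) : D y = D x := by
  have drift_eq : ∀ a, D a - (Q *ᵥ D) a = ∑ b, Q a b * (D a - D b) := fun a => by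
    simp only [mul_sub, Finset.sum_sub_distrib, ← Finset.sum_mul,
      sum_row_of_mem_rowStochastic hQ, one_mul]
    rfl
  have term_nonneg : ∀ a b, 0 ≤ Q a b * (D a - D b) := fun a b => by
    rcases (nonneg_of_mem_rowStochastic hQ : 0 ≤ Q a b).eq_or_lt with h | h
    · rw [← h, zero_mul]
    · exact mul_nonneg h.le (sub_nonneg.2 (hD a b h))
  have drift_nonneg : ∀ a, 0 ≤ D a - (Q *ᵥ D) a := fun a =>
    drift_eq a ▸ Finset.sum_nonneg fun b _ => term_nonneg a b
  have mean_drift : ∑ a, π a * (D a - (Q *ᵥ D) a) = 0 := by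
    simp only [mul_sub, Finset.sum_sub_distrib]
    exact sub_eq_zero.2 (hπ.dotProduct_mulVec D).symm
  induction hxy with
  | refl => rfl
  | @tail a b hxa hab ih =>
    have drift_zero : D a - (Q *ᵥ D) a = 0 :=
      (mul_eq_zero.1 ((Finset.sum_eq_zero_iff_of_nonneg fun a _ =>
        mul_nonneg (hπ.nonneg a) (drift_nonneg a)).1 mean_drift a (Finset.mem_univ a))).resolve_left
        (hπ.pos_of_reaches hQ hx hxa).ne'
    rw [drift_eq, Finset.sum_eq_zero_iff_of_nonneg fun b _ => term_nonneg a b] at drift_zero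
    rw [← ih, ← sub_eq_zero, ← neg_sub, neg_eq_zero]
    exact (mul_eq_zero.1 (drift_zero b (Finset.mem_univ b))).resolve_left hab.ne'

end StationaryDistribution

section DrivenChain

open Matrix

variable {S : Type*}

/-- The trajectory started at `s₀` that moves at time `n` from its current state `s` to
`ω (n, s)`. When the coordinates of `ω` are independent and `ω (n, s)` is distributed as a step
from `s`, this is a Markov chain. -/
def drivenChain (s₀ : S) : ℕ → (ℕ × S → S) → S
  | 0, _ => s₀
  | n + 1, ω => ω (n, drivenChain s₀ n ω)

lemma drivenChain_eq_iff {s₀ : S} {ω : ℕ × S → S} {n : ℕ} {z : ℕ → S} (hz : z 0 = s₀) :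
    (∀ k ≤ n, drivenChain s₀ k ω = z k) ↔ ∀ k < n, ω (k, z k) = z (k + 1) := by
  constructor
  · intro h k hk
    rw [← h (k + 1) hk, drivenChain, h k hk.le]
  · intro h k hk
    induction k with
    | zero => exact hz.symm
    | succ k ih => rw [drivenChain, ih (Nat.le_of_succ_le hk), h k hk]

lemma measurable_drivenChain [Countable S] [MeasurableSpace S] [DiscreteMeasurableSpace S]
    (s₀ : S) (n : ℕ) : Measurable (drivenChain s₀ n) := by
  induction n with
  | zero => exact measurable_const
  | succ n ih =>
    refine measurable_to_countable' fun s => ?_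
    have step_fiber : drivenChain s₀ (n + 1) ⁻¹' {s} =
        ⋃ t, drivenChain s₀ n ⁻¹' {t} ∩ (fun ω => ω (n, t)) ⁻¹' {s} := by
      ext ω
      simp [drivenChain]
    rw [step_fiber]
    exact .iUnion fun t => (ih (measurableSet_singleton t)).inter
      (measurable_pi_apply (n, t) (measurableSet_singleton s))

variable [Fintype S] [DecidableEq S] {Q : Matrix S S ℝ}

/-- The distribution of the state one step after `s`, for a chain with stochastic transition
matrix `Q`. -/
noncomputable def stepPMF (hQ : Q ∈ rowStochastic ℝ S) (s : S) : PMF S :=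
  PMF.ofFintype (fun y => ENNReal.ofReal (Q s y)) <| by
    rw [← ENNReal.ofReal_sum_of_nonneg fun y _ => nonneg_of_mem_rowStochastic hQ,
      sum_row_of_mem_rowStochastic hQ, ENNReal.ofReal_one]

theorem isMarkovChain_drivenChain [MeasurableSpace S] [DiscreteMeasurableSpace S]
    (hQ : Q ∈ rowStochastic ℝ S) (s₀ : S) :
    IsMarkovChain (Measure.infinitePi fun a : ℕ × S => (stepPMF hQ a.2).toMeasure) Q
      (drivenChain s₀) where
  measurableSet_fiber n s := measurable_drivenChain s₀ n (measurableSet_singleton s)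
  law n z := by
    by_cases hz : z 0 = s₀
    · have cylinder : {ω : ℕ × S → S | ∀ k ≤ n, drivenChain s₀ k ω = z k} =
          Set.pi ((Finset.range n).image fun k => (k, z k) : Finset (ℕ × S))
            fun a => {z (a.1 + 1)} := by
        ext ω
        simp [drivenChain_eq_iff hz]
      have injOn : Set.InjOn (fun k => (k, z k)) (Finset.range n : Set ℕ) :=
        fun a _ b _ hab => congrArg Prod.fst hab
      simp only [measureReal_def, cylinder, drivenChain, hz, Set.ofPred_true, measure_univ,
        Measure.infinitePi_pi _ fun _ _ => measurableSet_singleton _, Finset.prod_image injOn,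
        ENNReal.toReal_prod, ENNReal.toReal_one, one_mul]
      refine Finset.prod_congr rfl fun k _ => ?_
      rw [PMF.toMeasure_apply_singleton _ _ (measurableSet_singleton _), stepPMF,
        PMF.ofFintype_apply, ENNReal.toReal_ofReal (nonneg_of_mem_rowStochastic hQ)]
    · have start_empty : {ω : ℕ × S → S | drivenChain s₀ 0 ω = z 0} = ∅ :=
        Set.eq_empty_of_forall_notMem fun ω hω => hz (Eq.symm hω)
      have path_empty : {ω : ℕ × S → S | ∀ k ≤ n, drivenChain s₀ k ω = z k} = ∅ :=
        Set.eq_empty_of_forall_notMem fun ω hω => hz (hω 0 n.zero_le).symm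
      rw [start_empty, path_empty, measureReal_empty, zero_mul]

end DrivenChain

section Model

open Matrix

lemma changeProb_add_stayProb {N : ℕ} (p : Fin 4 → ℝ) (x : State N) (i : ZMod N) :
    changeProb p x i + stayProb p x i = 1 := by
  unfold changeProb stayProb
  split_ifs <;> ring

lemma changeProb_nonneg {N : ℕ} {p : Fin 4 → ℝ} (hp : ∀ m, p m ∈ Set.Icc (0 : ℝ) 1) (x : State N)
    (i : ZMod N) : 0 ≤ changeProb p x i := by
  unfold changeProb
  split_ifs
  exacts [(hp _).1, sub_nonneg.2 (hp _).2]

lemma stayProb_nonneg {N : ℕ} {p : Fin 4 → ℝ} (hp : ∀ m, p m ∈ Set.Icc (0 : ℝ) 1) (x : State N)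
    (i : ZMod N) : 0 ≤ stayProb p x i := by
  unfold stayProb
  split_ifs
  exacts [sub_nonneg.2 (hp _).2, (hp _).1]

/-- Expected value of `f` at the statuses obtained when player `i` plays in state `x`. It relates
the two chains: averaged over `i` it is the action of `P` on `f`, and `PStar` acts by averaging
over the next player and then applying it. -/
noncomputable def expectedAfterTurn {N : ℕ} (p : Fin 4 → ℝ) (f : State N → ℝ) (x : State N)
    (i : ZMod N) : ℝ :=
  changeProb p x i * f (flip x i) + stayProb p x i * f x

variable {N : ℕ} [NeZero N] {p : Fin 4 → ℝ}

lemma inv_mul_sum_const (c : ℝ) : (N : ℝ)⁻¹ * ∑ _i : ZMod N, c = c := by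
  rw [Finset.sum_const, Finset.card_univ, ZMod.card, nsmul_eq_mul,
    inv_mul_cancel_left₀ (Nat.cast_ne_zero.2 (NeZero.ne N))]

lemma P_mulVec (f : State N → ℝ) (x : State N) :
    (P N p *ᵥ f) x = (N : ℝ)⁻¹ * ∑ i, expectedAfterTurn p f x i := by
  simp only [mulVec, dotProduct, P, mul_assoc, Finset.sum_mul, ← Finset.mul_sum]
  rw [Finset.sum_comm]
  simp only [add_mul, ite_mul, zero_mul, Finset.sum_add_distrib, Finset.sum_ite_eq',
    Finset.mem_univ, if_true, expectedAfterTurn]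

lemma PStar_mulVec (F : StarState N → ℝ) (x : State N) (i : ZMod N) :
    (PStar N p *ᵥ F) (x, i) =
      expectedAfterTurn p (fun y => (N : ℝ)⁻¹ * ∑ j, F (y, j)) x i := by
  simp only [mulVec, dotProduct, PStar, mul_assoc, ← Finset.mul_sum, Fintype.sum_prod_type]
  simp only [add_mul, ite_mul, zero_mul, Finset.sum_add_distrib, Finset.sum_ite_irrel,
    ← Finset.mul_sum, Finset.sum_const_zero, Finset.sum_ite_eq', Finset.mem_univ, if_true,
    expectedAfterTurn]
  ring

lemma P_mem_rowStochastic (hp : ∀ m, p m ∈ Set.Icc (0 : ℝ) 1) :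
    P N p ∈ rowStochastic ℝ (State N) := by
  refine mem_rowStochastic.2 ⟨fun x y => ?_, funext fun x => ?_⟩
  · refine mul_nonneg (by positivity) (Finset.sum_nonneg fun i _ => ?_)
    have := changeProb_nonneg hp x i
    have := stayProb_nonneg hp x i
    positivity
  · simp only [P_mulVec, expectedAfterTurn, Pi.one_apply, mul_one, changeProb_add_stayProb,
      inv_mul_sum_const]

lemma PStar_mem_rowStochastic (hp : ∀ m, p m ∈ Set.Icc (0 : ℝ) 1) :
    PStar N p ∈ rowStochastic ℝ (StarState N) := by
  refine mem_rowStochastic.2 ⟨fun z w => ?_, funext fun ⟨x, i⟩ => ?_⟩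
  · have := changeProb_nonneg hp z.1 z.2
    have := stayProb_nonneg hp z.1 z.2
    unfold PStar
    positivity
  · simp only [PStar_mulVec, expectedAfterTurn, Pi.one_apply, mul_one, changeProb_add_stayProb,
      inv_mul_sum_const]

lemma P_pos_of_changeProb_pos (hp : ∀ m, p m ∈ Set.Icc (0 : ℝ) 1) {x : State N} {i : ZMod N}
    (h : 0 < changeProb p x i) : 0 < P N p x (flip x i) := by
  have nonneg : ∀ j, 0 ≤ (if flip x i = flip x j then changeProb p x j else 0) +
      (if flip x i = x then stayProb p x j else 0) := fun j => by
    have := changeProb_nonneg hp x j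
    have := stayProb_nonneg hp x j
    positivity
  have N_pos : (0 : ℝ) < N := Nat.cast_pos.2 (NeZero.pos N)
  refine mul_pos (inv_pos.2 N_pos)
    (Finset.sum_pos' (fun j _ => nonneg j) ⟨i, Finset.mem_univ i, ?_⟩)
  have := stayProb_nonneg hp x i
  rw [if_pos rfl]
  positivity

lemma eq_or_exists_flip_of_P_pos {x y : State N} (h : 0 < P N p x y) :
    y = x ∨ ∃ i, y = flip x i ∧ 0 < changeProb p x i := by
  by_contra! hxy
  refine h.not_ge (mul_nonpos_of_nonneg_of_nonpos (by positivity)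
    (Finset.sum_nonpos fun i _ => ?_))
  rw [if_neg hxy.1, add_zero]
  split_ifs with hi
  exacts [hxy.2 i hi, le_rfl]

/-- Expected profit of a turn in state `x`. -/
noncomputable def meanPayoff (p : Fin 4 → ℝ) (x : State N) : ℝ :=
  (N : ℝ)⁻¹ * ∑ i, (2 * p (nbr x i) - 1)

lemma sum_PStar_mul_payoff (x : State N) (i : ZMod N) :
    ∑ w, PStar N p (x, i) w * payoff (x, i) w = 2 * p (nbr x i) - 1 := by
  have payoff_mean : ∀ y : State N, (N : ℝ)⁻¹ * ∑ j : ZMod N, payoff (x, i) (y, j) =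
      if y i = 1 then 1 else -1 := fun y =>
    inv_mul_sum_const (if y i = 1 then 1 else -1)
  refine (PStar_mulVec (payoff (x, i)) x i).trans ?_
  simp only [expectedAfterTurn, payoff_mean, changeProb, stayProb, flip, Function.update_self]
  rcases Fin.exists_fin_two.1 ⟨x i, rfl⟩ with h | h
  · simp only [h, if_true, sub_zero, mul_one, if_neg zero_ne_one, mul_neg]
    ring
  · simp only [h, if_neg one_ne_zero, if_true, sub_self, if_neg zero_ne_one, mul_neg, mul_one]
    ring

lemma hasPoissonMean_PStar {μ : ℝ} (h : HasPoissonMean (P N p) (meanPayoff p) μ) :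
    HasPoissonMean (PStar N p) (fun z => ∑ w, PStar N p z w * payoff z w) μ := by
  obtain ⟨f, hf⟩ := h
  let F : StarState N → ℝ := fun z =>
    2 * p (nbr z.1 z.2) - 1 - μ + expectedAfterTurn p f z.1 z.2
  have F_mean : (fun x => (N : ℝ)⁻¹ * ∑ i, F (x, i)) = f := funext fun x => by
    have hfx := hf x
    rw [P_mulVec, meanPayoff] at hfx
    simp only [F, Finset.sum_add_distrib, Finset.sum_sub_distrib _ fun _ => μ, mul_add, mul_sub,
      inv_mul_sum_const]
    linarith
  refine ⟨F, fun ⟨x, i⟩ => ?_⟩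
  rw [PStar_mulVec, F_mean]
  simp only [F, sum_PStar_mul_payoff, add_sub_cancel_right]

theorem isMeanProfit_iff_of_hasPoissonMean (hp : ∀ m, p m ∈ Set.Icc (0 : ℝ) 1) {μ : ℝ}
    (h : HasPoissonMean (P N p) (meanPayoff p) μ) (μ' : ℝ) : IsMeanProfit N p μ' ↔ μ' = μ := by
  have hQ := PStar_mem_rowStochastic (N := N) hp
  have hμ : IsMeanProfit N p μ := fun Ω _ ℙ _ Z hZ =>
    hZ.ae_tendsto_average (one_vecMul_of_mem_rowStochastic hQ) (hasPoissonMean_PStar h)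
  refine ⟨fun hμ' => ?_, fun h => h ▸ hμ⟩
  let _ : MeasurableSpace (StarState N) := ⊤
  have chain := isMarkovChain_drivenChain hQ 0
  obtain ⟨ω, hω', hω⟩ := ((hμ' _ _ _ chain).and (hμ _ _ _ chain)).exists
  exact tendsto_nhds_unique hω' hω

/-- The number of winners. -/
def numWinners (x : State N) : ℝ := ∑ i, ((x i).val : ℝ)

lemma numWinners_flip (x : State N) (i : ZMod N) :
    numWinners (flip x i) = numWinners x + (1 - 2 * ((x i).val : ℝ)) := by
  rw [← sub_eq_iff_eq_add', numWinners, numWinners, ← Finset.sum_sub_distrib,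
    Fintype.sum_eq_single i fun j hj => by rw [flip, Function.update_of_ne hj, sub_self],
    flip, Function.update_self]
  rcases Fin.exists_fin_two.1 ⟨x i, rfl⟩ with h | h <;> norm_num [h]

lemma numWinners_drift (p : Fin 4 → ℝ) (x : State N) :
    (P N p *ᵥ numWinners) x - numWinners x =
      (N : ℝ)⁻¹ * (∑ i, p (nbr x i) - numWinners x) := by
  have turn : ∀ i, expectedAfterTurn p numWinners x i =
      numWinners x + (p (nbr x i) - ((x i).val : ℝ)) := fun i => by
    rw [expectedAfterTurn, numWinners_flip, changeProb, stayProb]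
    rcases Fin.exists_fin_two.1 ⟨x i, rfl⟩ with h | h
    · simp only [h, if_true, Fin.val_zero, Nat.cast_zero]
      ring
    · simp only [h, if_neg one_ne_zero, Fin.val_one, Nat.cast_one]
      ring
  rw [P_mulVec]
  simp only [turn, Finset.sum_add_distrib, Finset.sum_sub_distrib, mul_add, inv_mul_sum_const,
    add_sub_cancel_left]
  rfl

end Model

section AscentsAndDefects

variable {N : ℕ}

lemma prob_nbr (p₁ p₂ : ℝ) (x : State N) (i : ZMod N) :
    (![1, p₁, p₂, 0] : Fin 4 → ℝ) (nbr x i) =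
      if x (i - 1) = 0 then if x (i + 1) = 0 then 1 else p₁
      else if x (i + 1) = 0 then p₂ else 0 := by
  rcases Fin.exists_fin_two.1 ⟨x (i - 1), rfl⟩ with hl | hl <;>
    rcases Fin.exists_fin_two.1 ⟨x (i + 1), rfl⟩ with hr | hr <;>
    simp [nbr, hl, hr]

variable [NeZero N]

/-- The players whose left neighbour is a loser and whose right neighbour is a winner. -/
def ascents (x : State N) : Finset (ZMod N) :=
  {i | x (i - 1) = 0 ∧ x (i + 1) = 1}

/-- The players `i` whose status agrees with that of player `i + 1`. -/
def defects (x : State N) : Finset (ZMod N) :=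
  {i | x i = x (i + 1)}

lemma mem_defects {x : State N} {i : ZMod N} : i ∈ defects x ↔ x i = x (i + 1) :=
  Finset.mem_filter_univ i

lemma sub_one_mem_defects {x : State N} {i : ZMod N} : i - 1 ∈ defects x ↔ x (i - 1) = x i := by
  rw [mem_defects, sub_add_cancel]

lemma card_ascents (x : State N) :
    (ascents x).card = {i ∈ defects x | i - 1 ∉ defects x}.card := by
  -- The two indicators at `i` differ by the increment of `max (x i) (x (i + 1))`.
  have pointwise : ∀ a b c : Fin 2, (if a = 0 ∧ c = 1 then 1 else 0) + (max a b).val =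
      (if b = c ∧ a ≠ b then 1 else 0) + (max b c).val := by decide
  have shift : ∑ i, (max (x (i - 1)) (x i)).val = ∑ i, (max (x i) (x (i + 1))).val :=
    Fintype.sum_equiv (Equiv.subRight 1) _ _ fun i => by
      rw [Equiv.subRight_apply, sub_add_cancel]
  have sum_eq := Fintype.sum_congr _ _ fun i => pointwise (x (i - 1)) (x i) (x (i + 1))
  rw [Finset.sum_add_distrib, Finset.sum_add_distrib, shift, add_left_inj] at sum_eq
  simpa only [ascents, defects, Finset.card_filter, Finset.filter_filter, Finset.mem_filter_univ,
    sub_add_cancel] using sum_eq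

lemma card_ascents_eq_card_defects (hN : 2 ≤ N) {x : State N} (hx : (defects x).card ≤ 1) :
    (ascents x).card = (defects x).card := by
  have : Fact (1 < N) := ⟨hN⟩
  rw [card_ascents, Finset.filter_true_of_mem]
  exact fun i hi hi' => one_ne_zero (sub_eq_self.1 (Finset.card_le_one.1 hx _ hi' _ hi))

lemma card_defects_mod_two (x : State N) : (defects x).card % 2 = N % 2 := by
  have pointwise : ∀ a b : Fin 2, (if a = b then 1 else 0) = (1 + a.val + b.val : ZMod 2) := by
    decide
  have shift : ∑ i, ((x (i + 1)).val : ZMod 2) = ∑ i, ((x i).val : ZMod 2) :=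
    Equiv.sum_comp (Equiv.addRight (1 : ZMod N)) fun i => ((x i).val : ZMod 2)
  refine (ZMod.natCast_eq_natCast_iff' _ _ 2).1 ?_
  rw [defects, Finset.natCast_card_filter]
  simp only [pointwise, Finset.sum_add_distrib, shift, add_assoc, CharTwo.add_self_eq_zero]
  simp

lemma sum_prob_nbr (p₁ p₂ : ℝ) (x : State N) :
    ∑ i, (![1, p₁, p₂, 0] : Fin 4 → ℝ) (nbr x i) =
      N - numWinners x + (p₁ + p₂ - 1) * (ascents x).card := by
  have term : ∀ i, (![1, p₁, p₂, 0] : Fin 4 → ℝ) (nbr x i) = 1 - ((x (i - 1)).val : ℝ) +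
      (p₁ + p₂ - 1) * (if x (i - 1) = 0 ∧ x (i + 1) = 1 then 1 else 0) +
      p₂ * (((x (i - 1)).val : ℝ) - ((x (i + 1)).val : ℝ)) := fun i => by
    rw [prob_nbr]
    generalize x (i - 1) = a
    generalize x (i + 1) = c
    fin_cases a <;> fin_cases c <;> simp
  have shift_left : ∑ i, ((x (i - 1)).val : ℝ) = numWinners x :=
    Equiv.sum_comp (Equiv.subRight (1 : ZMod N)) fun i => ((x i).val : ℝ)
  have shift_right : ∑ i, ((x (i + 1)).val : ℝ) = numWinners x :=
    Equiv.sum_comp (Equiv.addRight (1 : ZMod N)) fun i => ((x i).val : ℝ)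
  simp only [term, Finset.sum_add_distrib, Finset.sum_sub_distrib, ← Finset.mul_sum, shift_left,
    shift_right, ascents, Finset.natCast_card_filter]
  simp [ZMod.card]

lemma meanPayoff_eq (p₁ p₂ : ℝ) (x : State N) :
    meanPayoff ![1, p₁, p₂, 0] x =
      ((P N ![1, p₁, p₂, 0]).mulVec numWinners x - numWinners x) +
        (p₁ + p₂ - 1) / N * (ascents x).card := by
  have hN : (N : ℝ) ≠ 0 := Nat.cast_ne_zero.2 (NeZero.ne N)
  rw [numWinners_drift, meanPayoff, Finset.sum_sub_distrib, ← Finset.mul_sum, sum_prob_nbr]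
  simp only [Finset.sum_const, Finset.card_univ, ZMod.card, nsmul_eq_mul]
  field_simp
  ring

lemma meanPayoff_gameC_eq (p₁ p₂ : ℝ) (x : State N) :
    meanPayoff (gameC ![1, p₁, p₂, 0]) x =
      2 / 3 * ((P N (gameC ![1, p₁, p₂, 0])).mulVec numWinners x - numWinners x) +
        2 / 3 * (p₁ + p₂ - 1) / N * (ascents x).card := by
  have hN : (N : ℝ) ≠ 0 := Nat.cast_ne_zero.2 (NeZero.ne N)
  have sum_gameC : ∑ i, gameC ![1, p₁, p₂, 0] (nbr x i) =
      (N / 2 + (N - numWinners x + (p₁ + p₂ - 1) * (ascents x).card)) / 2 := by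
    rw [← sum_prob_nbr]
    simp only [gameC, ← Finset.sum_div, Finset.sum_add_distrib, Finset.sum_const,
      Finset.card_univ, ZMod.card, nsmul_eq_mul, mul_one]
  rw [numWinners_drift, meanPayoff, Finset.sum_sub_distrib, ← Finset.mul_sum, sum_gameC]
  simp only [Finset.sum_const, Finset.card_univ, ZMod.card, nsmul_eq_mul]
  field_simp
  ring

end AscentsAndDefects

section GameB

open Matrix symmDiff

variable {N : ℕ} [NeZero N] {p₁ p₂ : ℝ}

lemma defects_flip (hN : 2 ≤ N) (x : State N) (i : ZMod N) :
    defects (flip x i) = defects x ∆ {i - 1, i} := by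
  have : Fact (1 < N) := ⟨hN⟩
  have one_sub_eq : ∀ a b : Fin 2, (1 - a = b ↔ ¬ a = b) ∧ (a = 1 - b ↔ ¬ a = b) := by decide
  have pred_ne : i - 1 ≠ i := fun h => one_ne_zero (sub_eq_self.1 h)
  have succ_ne : i + 1 ≠ i := add_ne_left.2 one_ne_zero
  ext j
  rw [Finset.mem_symmDiff, mem_defects, mem_defects, Finset.mem_insert, Finset.mem_singleton]
  rcases eq_or_ne j i with rfl | hj
  · simp [flip, succ_ne, one_sub_eq]
  rcases eq_or_ne j (i - 1) with rfl | hj'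
  · simp [flip, pred_ne, one_sub_eq]
  · have : j + 1 ≠ i := fun h => hj' (eq_sub_of_add_eq h)
    simp [flip, hj, hj', this]

lemma card_symmDiff_pair_le {α : Type*} [DecidableEq α] {s : Finset α} {a b : α} (ha : a ∈ s) :
    (s ∆ {a, b}).card ≤ s.card := by
  have subset : s ∆ {a, b} ⊆ insert b (s.erase a) := fun c hc => by
    simp only [Finset.mem_symmDiff, Finset.mem_insert, Finset.mem_singleton,
      Finset.mem_erase] at hc ⊢
    grind
  calc (s ∆ {a, b}).card ≤ (insert b (s.erase a)).card := Finset.card_le_card subset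
    _ ≤ (s.erase a).card + 1 := Finset.card_insert_le b _
    _ = s.card := Finset.card_erase_add_one ha

lemma card_defects_flip_le (hN : 2 ≤ N) {x : State N} {i : ZMod N}
    (h : i ∈ defects x ∨ i - 1 ∈ defects x) : (defects (flip x i)).card ≤ (defects x).card := by
  rw [defects_flip hN]
  rcases h with h | h
  · rw [Finset.pair_comm]
    exact card_symmDiff_pair_le h
  · exact card_symmDiff_pair_le h

lemma card_defects_flip_lt (hN : 2 ≤ N) {x : State N} {i : ZMod N} (h : i ∈ defects x)
    (h' : i - 1 ∈ defects x) : (defects (flip x i)).card < (defects x).card := by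
  rw [defects_flip hN]
  refine Finset.card_lt_card ((Finset.ssubset_iff_of_subset ?_).2 ⟨i, h, ?_⟩)
  · intro j hj
    simp only [Finset.mem_symmDiff, Finset.mem_insert, Finset.mem_singleton] at hj
    grind
  · simp [Finset.mem_symmDiff, h]

lemma probs_mem_Icc (hp₁ : p₁ ∈ Set.Icc (0 : ℝ) 1) (hp₂ : p₂ ∈ Set.Icc (0 : ℝ) 1) (m : Fin 4) :
    (![1, p₁, p₂, 0] : Fin 4 → ℝ) m ∈ Set.Icc (0 : ℝ) 1 := by
  fin_cases m
  exacts [⟨zero_le_one, le_rfl⟩, hp₁, hp₂, ⟨le_rfl, zero_le_one⟩]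

lemma changeProb_pos_iff (hp₁ : p₁ ∈ Set.Ioo (0 : ℝ) 1) (hp₂ : p₂ ∈ Set.Ioo (0 : ℝ) 1)
    {x : State N} {i : ZMod N} :
    0 < changeProb ![1, p₁, p₂, 0] x i ↔ i ∈ defects x ∨ i - 1 ∈ defects x := by
  rw [sub_one_mem_defects, mem_defects, changeProb, prob_nbr]
  generalize x (i - 1) = a
  generalize x i = b
  generalize x (i + 1) = c
  fin_cases a <;> fin_cases b <;> fin_cases c <;> simp [hp₁.1, hp₁.2, hp₂.1, hp₂.2]

lemma exists_reaches_card_defects_lt (hN : 2 ≤ N) (hp₁ : p₁ ∈ Set.Ioo (0 : ℝ) 1)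
    (hp₂ : p₂ ∈ Set.Ioo (0 : ℝ) 1) (d : ℕ) {x : State N} {i : ZMod N} (hi : i ∈ defects x)
    (hj : i + d ∈ defects x) (hij : i + d ≠ i) :
    ∃ y, Reaches (P N ![1, p₁, p₂, 0]) x y ∧ (defects y).card < (defects x).card := by
  induction d generalizing x i with
  | zero => simp at hij
  | succ d ih =>
    have hi' : i + 1 - 1 ∈ defects x := by rwa [add_sub_cancel_right]
    have step : 0 < P N ![1, p₁, p₂, 0] x (flip x (i + 1)) :=
      P_pos_of_changeProb_pos (probs_mem_Icc (Set.Ioo_subset_Icc_self hp₁)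
        (Set.Ioo_subset_Icc_self hp₂)) ((changeProb_pos_iff hp₁ hp₂).2 (.inr hi'))
    by_cases hsucc : i + 1 ∈ defects x
    · exact ⟨_, .single step, card_defects_flip_lt hN hsucc hi'⟩
    have assoc : i + 1 + (d : ZMod N) = i + (d + 1 : ℕ) := by push_cast; ring
    have hj_ne : i + (d + 1 : ℕ) ≠ i + 1 := fun h => hsucc (h ▸ hj)
    have defects_step := defects_flip hN x (i + 1)
    rw [add_sub_cancel_right] at defects_step
    obtain ⟨y, hy, hlt⟩ := @ih (flip x (i + 1)) (i + 1)
      (by simp [defects_step, Finset.mem_symmDiff, hsucc])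
      (by
        rw [assoc, defects_step, Finset.mem_symmDiff, Finset.mem_insert, Finset.mem_singleton]
        exact .inl ⟨hj, by simp only [hij, hj_ne, or_self, not_false_eq_true]⟩)
      (assoc ▸ hj_ne)
    exact ⟨y, .head step hy, hlt.trans_le (card_defects_flip_le hN (.inr hi'))⟩

lemma IsStationary.card_defects_le_one (hN : 2 ≤ N) (hp₁ : p₁ ∈ Set.Ioo (0 : ℝ) 1)
    (hp₂ : p₂ ∈ Set.Ioo (0 : ℝ) 1) {π : State N → ℝ}
    (hπ : IsStationary (P N ![1, p₁, p₂, 0]) π) {x : State N} (hx : 0 < π x) :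
    (defects x).card ≤ 1 := by
  have hQ := P_mem_rowStochastic (N := N)
    (probs_mem_Icc (Set.Ioo_subset_Icc_self hp₁) (Set.Ioo_subset_Icc_self hp₂))
  have antitone : ∀ a b, 0 < P N ![1, p₁, p₂, 0] a b →
      ((defects b).card : ℝ) ≤ (defects a).card := fun a b hab => by
    rcases eq_or_exists_flip_of_P_pos hab with rfl | ⟨i, rfl, hi⟩
    · exact le_rfl
    · exact Nat.cast_le.2 (card_defects_flip_le hN ((changeProb_pos_iff hp₁ hp₂).1 hi))
  by_contra! h
  obtain ⟨i, hi, j, hj, hij⟩ := Finset.one_lt_card.1 h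
  have add_val : i + ((j - i).val : ZMod N) = j := by
    rw [ZMod.natCast_zmod_val, add_sub_cancel]
  obtain ⟨y, hxy, hlt⟩ := exists_reaches_card_defects_lt hN hp₁ hp₂ (j - i).val hi
    (by rwa [add_val]) (by rwa [add_val, ne_comm])
  exact hlt.ne (Nat.cast_injective (hπ.eq_of_reaches_of_antitone hQ antitone hx hxy))

theorem isMeanProfit_gameB_iff (hN : 2 ≤ N) (hp₁ : p₁ ∈ Set.Ioo (0 : ℝ) 1)
    (hp₂ : p₂ ∈ Set.Ioo (0 : ℝ) 1) (μ : ℝ) :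
    IsMeanProfit N ![1, p₁, p₂, 0] μ ↔ μ = (p₁ + p₂ - 1) / N * (N % 2 : ℕ) := by
  have hp := probs_mem_Icc (Set.Ioo_subset_Icc_self hp₁) (Set.Ioo_subset_Icc_self hp₂)
  have mean_ascents : HasPoissonMean (P N ![1, p₁, p₂, 0])
      (fun x => ((ascents x).card : ℝ)) (N % 2 : ℕ) := by
    refine hasPoissonMean_of_forall_isStationary (P_mem_rowStochastic hp) fun π hπ => ?_
    rw [← one_mul ((N % 2 : ℕ) : ℝ), ← hπ.sum_eq_one, Finset.sum_mul]
    refine Finset.sum_congr rfl fun x _ => ?_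
    rcases (hπ.nonneg x).eq_or_lt with hx | hx
    · rw [← hx, zero_mul, zero_mul]
    · simp only
      have le_one := hπ.card_defects_le_one hN hp₁ hp₂ hx
      rw [card_ascents_eq_card_defects hN le_one, ← card_defects_mod_two x,
        Nat.mod_eq_of_lt (Nat.lt_succ_of_le le_one)]
  refine isMeanProfit_iff_of_hasPoissonMean hp ?_ μ
  simpa only [← meanPayoff_eq, zero_add] using
    (hasPoissonMean_drift _ numWinners).add (mean_ascents.const_mul ((p₁ + p₂ - 1) / N))

end GameB

section Rotation

variable {N : ℕ}

/-- Rotation of the circle of players, as a permutation of the set of states. -/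
def rotate (k : ZMod N) : State N ≃ State N := (Equiv.addRight k).arrowCongr (Equiv.refl _) |>.symm

lemma rotate_apply (k : ZMod N) (x : State N) (i : ZMod N) : rotate k x i = x (i + k) := rfl

lemma nbr_rotate (k : ZMod N) (x : State N) (i : ZMod N) : nbr (rotate k x) i = nbr x (i + k) := by
  simp only [nbr, rotate_apply, sub_add_eq_add_sub, add_right_comm]

lemma flip_rotate (k : ZMod N) (x : State N) (i : ZMod N) :
    flip (rotate k x) i = rotate k (flip x (i + k)) := by
  funext j
  simp only [flip, rotate_apply, Function.update_apply, add_left_inj]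

variable [NeZero N] {p : Fin 4 → ℝ} {π : State N → ℝ}

lemma P_submatrix_rotate (p : Fin 4 → ℝ) (k : ZMod N) :
    (P N p).submatrix (rotate k) (rotate k) = P N p := by
  ext x y
  refine congrArg _ (Fintype.sum_equiv (Equiv.addRight k) _ _ fun i => ?_)
  simp only [flip_rotate, changeProb, stayProb, nbr_rotate, rotate_apply,
    EmbeddingLike.apply_eq_iff_eq, Equiv.coe_addRight]
  congr!

lemma dotProduct_card_ascents (hπ : ∀ k x, π (rotate k x) = π x) :
    ∑ x, π x * (ascents x).card = N * marginal13 π 0 1 := by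
  have ascent_prob : ∀ i : ZMod N,
      ∑ x, π x * (if x (i - 1) = 0 ∧ x (i + 1) = 1 then 1 else 0) = marginal13 π 0 1 := fun i =>
    Fintype.sum_equiv (rotate (i - 2)) _ _ fun x => by
      have left : 1 + (i - 2) = i - 1 := by ring
      have right : 3 + (i - 2) = i + 1 := by ring
      simp only [rotate_apply, left, right, hπ, mul_ite, mul_one, mul_zero]
  simp only [ascents, Finset.natCast_card_filter, Finset.mul_sum]
  rw [Finset.sum_comm]
  simp only [ascent_prob, Finset.sum_const, Finset.card_univ, ZMod.card, nsmul_eq_mul]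

lemma marginal13_pos (hN : 3 ≤ N) (hπ : ∀ x, 0 < π x) : 0 < marginal13 π 0 1 := by
  have : Fact (1 < N) := ⟨by lia⟩
  have two_ne_zero : ((2 : ℕ) : ZMod N) ≠ 0 := fun h =>
    absurd (Nat.le_of_dvd two_pos ((ZMod.natCast_eq_zero_iff 2 N).1 h)) (by lia)
  have one_ne_three : (1 : ZMod N) ≠ 3 := fun h => two_ne_zero <| by
    push_cast
    linear_combination -h
  let w : State N := Function.update 0 3 1
  have hw : w 1 = 0 ∧ w 3 = 1 :=
    ⟨Function.update_of_ne one_ne_three _ _, Function.update_self _ _ _⟩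
  refine Finset.sum_pos' (fun x _ => ?_) ⟨w, Finset.mem_univ w, ?_⟩
  · split_ifs
    exacts [(hπ x).le, le_rfl]
  · rw [if_pos hw]
    exact hπ w

end Rotation

section GameC

variable {N : ℕ} {p : Fin 4 → ℝ}

lemma gameC_mem_Ioo (hp : ∀ m, p m ∈ Set.Icc (0 : ℝ) 1) (m : Fin 4) :
    gameC p m ∈ Set.Ioo (0 : ℝ) 1 := by
  rw [gameC]
  constructor <;> linarith [(hp m).1, (hp m).2]

lemma changeProb_pos (hp : ∀ m, p m ∈ Set.Ioo (0 : ℝ) 1) (x : State N) (i : ZMod N) :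
    0 < changeProb p x i := by
  unfold changeProb
  split_ifs
  exacts [(hp _).1, sub_pos.2 (hp _).2]

variable [NeZero N]

lemma reaches_update (hp : ∀ m, p m ∈ Set.Ioo (0 : ℝ) 1) (x : State N) (i : ZMod N) (b : Fin 2) :
    Reaches (P N p) x (Function.update x i b) := by
  have eq_or_eq_one_sub : ∀ a b : Fin 2, b = a ∨ b = 1 - a := by decide
  rcases eq_or_eq_one_sub (x i) b with rfl | rfl
  · rw [Function.update_eq_self]
    exact .refl
  · exact .single (P_pos_of_changeProb_pos (fun m => Set.Ioo_subset_Icc_self (hp m))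
      (changeProb_pos hp x i))

lemma reaches_of_forall_mem_Ioo (hp : ∀ m, p m ∈ Set.Ioo (0 : ℝ) 1) (x y : State N) :
    Reaches (P N p) x y := by
  suffices h : ∀ s : Finset (ZMod N), Reaches (P N p) x (s.piecewise y x) by
    simpa only [Finset.piecewise_univ] using h Finset.univ
  intro s
  induction s using Finset.induction with
  | empty =>
    rw [Finset.piecewise_empty]
    exact .refl
  | insert i s _ ih =>
    rw [Finset.piecewise_insert]
    exact ih.trans (reaches_update hp _ i (y i))

theorem exists_pos_unique_isStationary (hp : ∀ m, p m ∈ Set.Ioo (0 : ℝ) 1) :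
    ∃ π, IsStationary (P N p) π ∧ (∀ x, 0 < π x) ∧ ∀ π', IsStationary (P N p) π' → π' = π := by
  have hQ := P_mem_rowStochastic (N := N) fun m => Set.Ioo_subset_Icc_self (hp m)
  have irreducible := reaches_of_forall_mem_Ioo (N := N) hp
  obtain ⟨π, hπ⟩ := exists_isStationary hQ
  exact ⟨π, hπ, hπ.pos hQ irreducible, fun π' hπ' => hπ'.eq hQ irreducible hπ⟩

lemma IsStationary.apply_rotate (hp : ∀ m, p m ∈ Set.Ioo (0 : ℝ) 1) {π : State N → ℝ}
    (hπ : IsStationary (P N p) π) (k : ZMod N) (x : State N) : π (rotate k x) = π x := by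
  have rotated := hπ.submatrix (rotate k)
  rw [P_submatrix_rotate] at rotated
  exact congrFun (rotated.eq (P_mem_rowStochastic fun m => Set.Ioo_subset_Icc_self (hp m))
    (reaches_of_forall_mem_Ioo hp) hπ) x

theorem isMeanProfit_gameC_iff {p₁ p₂ : ℝ} (hp₁ : p₁ ∈ Set.Icc (0 : ℝ) 1)
    (hp₂ : p₂ ∈ Set.Icc (0 : ℝ) 1) {π : State N → ℝ}
    (hπ : IsStationary (P N (gameC ![1, p₁, p₂, 0])) π) (μ : ℝ) :
    IsMeanProfit N (gameC ![1, p₁, p₂, 0]) μ ↔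
      μ = 2 / 3 * (p₁ + p₂ - 1) * marginal13 π 0 1 := by
  have hp := gameC_mem_Ioo (probs_mem_Icc hp₁ hp₂)
  have hp' := fun m => Set.Ioo_subset_Icc_self (hp m)
  have hN : (N : ℝ) ≠ 0 := Nat.cast_ne_zero.2 (NeZero.ne N)
  have mean_ascents : HasPoissonMean (P N (gameC ![1, p₁, p₂, 0]))
      (fun x => ((ascents x).card : ℝ)) (N * marginal13 π 0 1) := by
    refine hasPoissonMean_of_forall_isStationary (P_mem_rowStochastic hp') fun π' hπ' => ?_
    rw [hπ'.eq (P_mem_rowStochastic hp') (reaches_of_forall_mem_Ioo hp) hπ]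
    exact dotProduct_card_ascents (hπ.apply_rotate hp)
  have mean_eq : 2 / 3 * (p₁ + p₂ - 1) * marginal13 π 0 1 =
      2 / 3 * 0 + 2 / 3 * (p₁ + p₂ - 1) / N * (N * marginal13 π 0 1) := by
    field_simp
    ring
  rw [mean_eq]
  refine isMeanProfit_iff_of_hasPoissonMean hp' ?_ μ
  simpa only [← meanPayoff_gameC_eq] using
    ((hasPoissonMean_drift _ numWinners).const_mul (2 / 3)).add
      (mean_ascents.const_mul (2 / 3 * (p₁ + p₂ - 1) / N))

end GameC

end Parrondo

open Parrondo in
theorem mainTheorem1_general {p₁ p₂ : ℝ} (hp₁ : p₁ ∈ Set.Ioo (0 : ℝ) 1)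
    (hp₂ : p₂ ∈ Set.Ioo (0 : ℝ) 1) (hsum : 1 < p₁ + p₂) {N : ℕ} [NeZero N] (hN : 3 ≤ N) :
    (Even N → ∀ μ : ℝ, IsMeanProfit N ![1, p₁, p₂, 0] μ ↔ μ = 0) ∧
    (Odd N →
      (∀ μ : ℝ, IsMeanProfit N ![1, p₁, p₂, 0] μ ↔ μ = (p₁ + p₂ - 1) / N) ∧
        0 < (p₁ + p₂ - 1) / N) ∧
    (∃ π : State N → ℝ, IsStationary (P N (gameC ![1, p₁, p₂, 0])) π ∧
      (∀ π' : State N → ℝ, IsStationary (P N (gameC ![1, p₁, p₂, 0])) π' → π' = π) ∧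
      (∀ μ : ℝ, IsMeanProfit N (gameC ![1, p₁, p₂, 0]) μ ↔
        μ = 2 / 3 * (p₁ + p₂ - 1) * marginal13 π 0 1) ∧
      0 < 2 / 3 * (p₁ + p₂ - 1) * marginal13 π 0 1) ∧
    (ParrondoEffect N ![1, p₁, p₂, 0] ↔ Even N) := by
  have gain_pos : 0 < p₁ + p₂ - 1 := sub_pos.2 hsum
  have meanB := isMeanProfit_gameB_iff (by lia : 2 ≤ N) hp₁ hp₂
  have even (h : Even N) (μ : ℝ) : IsMeanProfit N ![1, p₁, p₂, 0] μ ↔ μ = 0 := by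
    rw [meanB, Nat.even_iff.1 h, Nat.cast_zero, mul_zero]
  have odd (h : Odd N) (μ : ℝ) :
      IsMeanProfit N ![1, p₁, p₂, 0] μ ↔ μ = (p₁ + p₂ - 1) / N := by
    rw [meanB, Nat.odd_iff.1 h, Nat.cast_one, mul_one]
  have odd_pos : 0 < (p₁ + p₂ - 1) / N := div_pos gain_pos (Nat.cast_pos.2 (NeZero.pos N))
  have hp₁' := Set.Ioo_subset_Icc_self hp₁
  have hp₂' := Set.Ioo_subset_Icc_self hp₂
  obtain ⟨π, hπ, π_pos, π_unique⟩ :=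
    exists_pos_unique_isStationary (N := N) (gameC_mem_Ioo (probs_mem_Icc hp₁' hp₂'))
  have meanC := isMeanProfit_gameC_iff hp₁' hp₂' hπ
  have meanC_pos : 0 < 2 / 3 * (p₁ + p₂ - 1) * marginal13 π 0 1 :=
    mul_pos (by positivity) (marginal13_pos hN π_pos)
  refine ⟨even, fun h => ⟨odd h, odd_pos⟩, ⟨π, hπ, π_unique, meanC, meanC_pos⟩, ?_,
    fun h => ⟨0, _, (even h 0).2 rfl, (meanC _).2 rfl, le_rfl, meanC_pos⟩⟩
  rintro ⟨μB, μC, hB, -, hB0, -⟩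
  by_contra h
  exact hB0.not_gt ((odd (Nat.not_even_iff_odd.1 h) μB).1 hB ▸ odd_pos)

/-- `∀ μ, IsMeanProfit N p μ ↔ μ = a` says that the mean profit per turn exists, is unique,
and equals `a`. -/
theorem mainTheorem1 (p₁ p₂ : ℝ) (h₁₂ : p₁ = p₂) (h₁ : p₁ ∈ Set.Ioo (1 / 2 : ℝ) 1)
    (N : ℕ) [NeZero N] (hN : 3 ≤ N) :
    (Even N → ∀ μ : ℝ, Parrondo.IsMeanProfit N ![1, p₁, p₂, 0] μ ↔ μ = 0) ∧
    (Odd N →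
      (∀ μ : ℝ, Parrondo.IsMeanProfit N ![1, p₁, p₂, 0] μ ↔ μ = (p₁ + p₂ - 1) / N) ∧
        0 < (p₁ + p₂ - 1) / N) ∧
    (∃ π : Parrondo.State N → ℝ,
      Parrondo.IsStationary (Parrondo.P N (Parrondo.gameC ![1, p₁, p₂, 0])) π ∧
      (∀ π' : Parrondo.State N → ℝ,
        Parrondo.IsStationary (Parrondo.P N (Parrondo.gameC ![1, p₁, p₂, 0])) π' → π' = π) ∧
      (∀ μ : ℝ, Parrondo.IsMeanProfit N (Parrondo.gameC ![1, p₁, p₂, 0]) μ ↔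
        μ = 2 / 3 * (2 * p₁ - 1) * Parrondo.marginal13 π 0 1) ∧
      0 < 2 / 3 * (2 * p₁ - 1) * Parrondo.marginal13 π 0 1) ∧
    (Parrondo.ParrondoEffect N ![1, p₁, p₂, 0] ↔ Even N) := by
  subst h₁₂
  have hp₁ : p₁ ∈ Set.Ioo (0 : ℝ) 1 := ⟨by linarith [h₁.1], h₁.2⟩
  simpa only [two_mul] using mainTheorem1_general hp₁ hp₁ (by linarith [h₁.1]) hN
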